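/- Let $E$ be a Hilbert $C^*$-module over an arbitrary (not necessarily unital) $C^*$-algebra $A$. Let $L(E)$ be the $C^*$-algebra of bounded adjointable operators on $E$ with the operator norm, and let $K(E)\subseteq L(E)$ be the compact operators, i.e. the norm-closed linear span of the rank one operators $z\mapsto x\langle y,z\rangle$, $x,y\in E$ (if $A$ acts on the left and the inner product is $A$-linear in its second variable, $z\mapsto \langle y,z\rangle x$). A closed, densely defined, $A$-linear operator $t:D(t)\subseteq E\to E$ with densely defined adjoint $t^*$ is called regular if $1+t^*t$ has dense range, and a regular operator is selfadjoint if $t=t^*$. A regular operator $t$ is called Fredholm if it has a pseudo left inverse, i.e. some $G\in L(E)$ such that $Gt$ is closable with $\overline{Gt}\in L(E)$ and $\overline{Gt}-1\in K(E)$, and a pseudo right inverse, i.e. some $G\in L(E)$ such that $tG$ is closable with $\overline{tG}\in L(E)$ and $\overline{tG}-1\in K(E)$. Theorem. Let $t$ be a selfadjoint regular Fredholm operator on $E$. Then there exists $\varepsilon>0$ such that for every selfadjoint bounded operator $D\in L(E)$ with $\|D\|\le\varepsilon$ the operator $t+D$, with domain $D(t)$, is a selfadjoint regular Fredholm operator.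 -/

import Mathlib

/-!
Unbounded operators on a Hilbert C⋆-module `E` over a (not necessarily unital) C⋆-algebra `A`.
Mathlib's `CStarModule A E` writes the action of `A` on the left, with an inner product that is
linear in the second variable: `inner A x (a • y) = a * inner A x y`.
-/

noncomputable section

namespace HilbertCStar

variable (A : Type*) {E : Type*} [NonUnitalCStarAlgebra A] [PartialOrder A] [StarOrderedRing A]
  [NormedAddCommGroup E] [NormedSpace ℂ E] [SMul A E] [CStarModule A E]

/-- Membership in `L(E)`: the bounded operator `S` has an adjoint for the `A`-valued inner
product. -/
def IsAdjointable (S : E →L[ℂ] E) : Prop :=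
  ∃ S' : E →L[ℂ] E, ∀ x y : E, inner A (S x) y = inner A x (S' y)

/-- The bounded operator `D` is its own adjoint, so that `D` belongs to `L(E)` and `D = D⋆`. -/
def IsSelfAdjointBounded (D : E →L[ℂ] E) : Prop :=
  ∀ x y : E, inner A (D x) y = inner A x (D y)

/-- The rank one operator `z ↦ ⟪y, z⟫ • x`. -/
def rankOne (x y : E) : E →L[ℂ] E :=
  LinearMap.mkContinuous
    { toFun := fun z => inner A y z • x
      map_add' := fun z w => by
        have key : ∀ a b : A, (a + b) • x = a • x + b • x := fun a b => by
          have h : inner A ((a + b) • x - (a • x + b • x)) ((a + b) • x - (a • x + b • x))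
              = (0 : A) := by
            rw [CStarModule.inner_sub_right, CStarModule.inner_add_right]
            simp only [CStarModule.inner_op_smul_right, add_mul, sub_self]
          exact sub_eq_zero.mp (CStarModule.inner_self.mp h)
        rw [CStarModule.inner_add_right, key]
      map_smul' := fun c z => by
        have key : ∀ a : A, (c • a) • x = c • (a • x) := fun a => by
          have h : inner A ((c • a) • x - c • (a • x)) ((c • a) • x - c • (a • x)) = (0 : A) := by
            rw [CStarModule.inner_sub_right]
            simp only [CStarModule.inner_op_smul_right, CStarModule.inner_smul_right_complex,
              smul_mul_assoc, sub_self]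
          exact sub_eq_zero.mp (CStarModule.inner_self.mp h)
        rw [CStarModule.inner_smul_right_complex, key, RingHom.id_apply] }
    (‖y‖ * ‖x‖) (fun z => by
      have hsm : ∀ a : A, ‖a • x‖ ≤ ‖a‖ * ‖x‖ := fun a => by
        have h1 : ‖a • x‖ ^ 2 ≤ (‖a‖ * ‖x‖) ^ 2 := by
          rw [CStarModule.norm_sq_eq A, CStarModule.inner_op_smul_right,
            CStarModule.inner_op_smul_left]
          calc ‖a * (inner A x x * star a)‖ ≤ ‖a‖ * (‖(inner A x x : A)‖ * ‖star a‖) :=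
                (norm_mul_le _ _).trans (by gcongr; exact norm_mul_le _ _)
            _ = (‖a‖ * ‖x‖) ^ 2 := by
                rw [norm_star, ← CStarModule.norm_sq_eq A]; ring
        exact le_of_sq_le_sq h1 (by positivity)
      calc ‖(inner A y z : A) • x‖ ≤ ‖(inner A y z : A)‖ * ‖x‖ := hsm _
        _ ≤ (‖y‖ * ‖z‖) * ‖x‖ := by gcongr; exact CStarModule.norm_inner_le E
        _ = ‖y‖ * ‖x‖ * ‖z‖ := by ring)

variable (E) in
/-- The compact operators `K(E)`: the norm closure of the linear span of the rank one operators. -/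
def compactOperators : Submodule ℂ (E →L[ℂ] E) :=
  (Submodule.span ℂ (Set.range fun p : E × E => rankOne A p.1 p.2)).topologicalClosure

/-- The pairs `(y, z)` with `⟪t x, y⟫ = ⟪x, z⟫` for all `x` in the domain of `t`. -/
def adjointGraph (t : E →ₗ.[ℂ] E) : Submodule ℂ (E × E) where
  carrier := {p | ∀ x : t.domain, inner A (t x) p.1 = inner A (x : E) p.2}
  add_mem' := fun {p q} hp hq x => by
    rw [Prod.fst_add, Prod.snd_add, CStarModule.inner_add_right, CStarModule.inner_add_right,
      hp x, hq x]
  zero_mem' := fun x => by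
    rw [Prod.fst_zero, Prod.snd_zero, CStarModule.inner_zero_right, CStarModule.inner_zero_right]
  smul_mem' := fun c p hp x => by
    rw [Prod.smul_fst, Prod.smul_snd, CStarModule.inner_smul_right_complex,
      CStarModule.inner_smul_right_complex, hp x]

/-- The adjoint `t⋆`: the operator whose graph is `adjointGraph A t`. It is meaningful when `t` is
densely defined, see `graph_adjoint`. -/
def adjoint (t : E →ₗ.[ℂ] E) : E →ₗ.[ℂ] E :=
  (adjointGraph A t).toLinearPMap

theorem graph_adjoint (t : E →ₗ.[ℂ] E) (ht : Dense (t.domain : Set E)) :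
    (adjoint A t).graph = adjointGraph A t := by
  refine Submodule.toLinearPMap_graph_eq _ fun p hp hp0 => ?_
  have h : ∀ x ∈ (t.domain : Set E), inner A x p.2 = (0 : A) := fun x hx => by
    rw [← hp ⟨x, hx⟩, hp0, CStarModule.inner_zero_right]
  have hc : Continuous fun x : E => (inner A x p.2 : A) :=
    (CStarModule.continuous_inner (A := A) (E := E)).comp (continuous_id.prodMk continuous_const)
  have h' : (fun x : E => (inner A x p.2 : A)) = fun _ => 0 :=
    hc.ext_on ht continuous_const h
  exact CStarModule.inner_self.mp (congrFun h' p.2)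

/-- The domain of `t` is an `A`-submodule and `t` is `A`-linear. -/
def IsModuleMap (t : E →ₗ.[ℂ] E) : Prop :=
  ∀ (a : A) (x : t.domain), ∃ h : a • (x : E) ∈ t.domain, t ⟨a • (x : E), h⟩ = a • t x

/-- A regular operator: an `A`-linear, closed, densely defined operator `t` with densely defined
adjoint such that `1 + t⋆ t` (with its natural domain) has dense range. -/
structure IsRegular (t : E →ₗ.[ℂ] E) : Prop where
  isModuleMap : IsModuleMap A t
  isClosed : t.IsClosed
  dense_domain : Dense (t.domain : Set E)
  dense_adjoint_domain : Dense ((adjoint A t).domain : Set E)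
  dense_range : Dense {z : E | ∃ (x : t.domain) (hx : t x ∈ (adjoint A t).domain),
    z = x + adjoint A t ⟨t x, hx⟩}

/-- A densely defined operator (for instance a regular one) is selfadjoint if `t = t⋆`. -/
def IsSelfAdjointOp (t : E →ₗ.[ℂ] E) : Prop :=
  adjoint A t = t

/-- The composition `t G`, with natural domain `{x | G x ∈ D(t)}`. -/
def compBounded (t : E →ₗ.[ℂ] E) (G : E →L[ℂ] E) : E →ₗ.[ℂ] E where
  domain := t.domain.comap (G : E →ₗ[ℂ] E)
  toFun := t.toFun.comp ((G : E →ₗ[ℂ] E).restrict fun _ hx => hx)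

/-- `T` is closable, its closure is everywhere defined and belongs to `L(E)`, and this closure is
congruent to `1` modulo `K(E)`. -/
def ClosureCongrOne (T : E →ₗ.[ℂ] E) : Prop :=
  T.IsClosable ∧ ∃ S : E →L[ℂ] E, IsAdjointable A S ∧
    T.closure = (S : E →ₗ[ℂ] E).toPMap ⊤ ∧ S - 1 ∈ compactOperators A E

/-- `G ∈ L(E)` is a pseudo left inverse of `t`. -/
def IsPseudoLeftInverse (G : E →L[ℂ] E) (t : E →ₗ.[ℂ] E) : Prop :=
  IsAdjointable A G ∧ ClosureCongrOne A ((G : E →ₗ[ℂ] E).compPMap t)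

/-- `G ∈ L(E)` is a pseudo right inverse of `t`. -/
def IsPseudoRightInverse (G : E →L[ℂ] E) (t : E →ₗ.[ℂ] E) : Prop :=
  IsAdjointable A G ∧ ClosureCongrOne A (compBounded t G)

/-- A Fredholm operator: a regular operator with a pseudo left and a pseudo right inverse. -/
structure IsFredholm (t : E →ₗ.[ℂ] E) : Prop where
  isRegular : IsRegular A t
  exists_left : ∃ G : E →L[ℂ] E, IsPseudoLeftInverse A G t
  exists_right : ∃ G : E →L[ℂ] E, IsPseudoRightInverse A G t

end HilbertCStar

end

noncomputable section

namespace HilbertCStar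

variable {A : Type*} {E : Type*} [NonUnitalCStarAlgebra A] [PartialOrder A]
  [NormedAddCommGroup E] [NormedSpace ℂ E] [SMul A E] [CStarModule A E]

/-! ### Hilbert modules and adjointable operators -/

/-! Write `T = t + D`. Adding a bounded operator shears the graph, so closedness and selfadjointness
pass from `t` to `T`. For regularity, `t + c` with `c = ±i` is bounded below on the closed graph of
`t` and has dense range, hence has a contractive resolvent `R` (`IsRegular.exists_resolvent`). Then
`T + c = (1 + DR)(t + c)` is onto when `‖D‖ < 1`, and so is `1 + T² = (T + i)(T - i)`.

If `Gt` extends to `S` with `S - 1` compact, then `G(t + D)` extends to `(1 + GD) + (S - 1)`. For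
small `D` the first summand is invertible in `L(E)`; multiplying by its inverse `V` leaves `1 + V(S
- 1)`, and `K(E)` is an ideal. Right inverses are symmetric, with closedness of `t` making `tG`
everywhere defined. -/

variable (A) in
theorem ext_inner_left {u v : E} (h : ∀ z : E, inner A z u = inner A z v) : u = v := by
  refine sub_eq_zero.mp ((CStarModule.inner_self (A := A)).mp ?_)
  rw [CStarModule.inner_sub_right, h, sub_self]

/-- `E` carries only `SMul A E`; distributivity comes from the inner product, which separates
points. -/
theorem op_smul_add (a : A) (x y : E) : a • (x + y) = a • x + a • y :=
  ext_inner_left A fun z => by simp [mul_add]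

theorem inner_eq_of_inner_eq {S S' : E →L[ℂ] E}
    (h : ∀ x y : E, inner A (S x) y = inner A x (S' y)) (x y : E) :
    inner A (S' x) y = inner A x (S y) := by
  rw [← CStarModule.star_inner, ← h, CStarModule.star_inner]

theorem IsSelfAdjointBounded.isAdjointable {D : E →L[ℂ] E} (hD : IsSelfAdjointBounded A D) :
    IsAdjointable A D :=
  ⟨D, hD⟩

theorem IsAdjointable.add {S T : E →L[ℂ] E} (hS : IsAdjointable A S) (hT : IsAdjointable A T) :
    IsAdjointable A (S + T) := by
  obtain ⟨S', hS⟩ := hS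
  obtain ⟨T', hT⟩ := hT
  exact ⟨S' + T', fun x y => by simp [hS, hT]⟩

theorem IsAdjointable.mul {S T : E →L[ℂ] E} (hS : IsAdjointable A S) (hT : IsAdjointable A T) :
    IsAdjointable A (S * T) := by
  obtain ⟨S', hS⟩ := hS
  obtain ⟨T', hT⟩ := hT
  exact ⟨T' * S', fun x y => by simp [hS, hT]⟩

theorem IsAdjointable.map_op_smul {S : E →L[ℂ] E} (hS : IsAdjointable A S) (a : A) (x : E) :
    S (a • x) = a • S x := by
  obtain ⟨S', hS⟩ := hS
  refine ext_inner_left A fun z => ?_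
  rw [← inner_eq_of_inner_eq hS, CStarModule.inner_op_smul_right,
    CStarModule.inner_op_smul_right, inner_eq_of_inner_eq hS]

theorem isModuleMap_vadd {t : E →ₗ.[ℂ] E} {D : E →L[ℂ] E} (ht : IsModuleMap A t)
    (hD : IsAdjointable A D) : IsModuleMap A ((D : E →ₗ[ℂ] E) +ᵥ t) := fun a x => by
  obtain ⟨h, hx⟩ := ht a x
  refine ⟨h, ?_⟩
  change D (a • (x : E)) + t ⟨a • (x : E), h⟩ = a • (D x + t x)
  rw [hx, hD.map_op_smul, op_smul_add]

/-- If `B` and its adjoint have norm less than one, then `1 + B` is invertible in `L(E)`. -/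
theorem exists_isAdjointable_inverse_one_add [CompleteSpace E] {B B' : E →L[ℂ] E}
    (h : ∀ x y : E, inner A (B x) y = inner A x (B' y)) (hB : ‖B‖ < 1) (hB' : ‖B'‖ < 1) :
    ∃ V : E →L[ℂ] E, IsAdjointable A V ∧ (1 + B) * V = 1 ∧ V * (1 + B) = 1 := by
  have inv : ∀ C : E →L[ℂ] E, ‖C‖ < 1 → ∃ V, (1 + C) * V = 1 ∧ V * (1 + C) = 1 := fun C hC =>
    have hC' : ‖-C‖ < 1 := by rwa [norm_neg]
    have hu : (Units.oneSub (-C) hC' : E →L[ℂ] E) = 1 + C := by simp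
    ⟨_, hu ▸ (Units.oneSub (-C) hC').mul_inv, hu ▸ (Units.oneSub (-C) hC').inv_mul⟩
  obtain ⟨V, hV₁, hV₂⟩ := inv B hB
  obtain ⟨W, hW₁, hW₂⟩ := inv B' hB'
  -- The adjoint of `(1 + B)⁻¹` is `(1 + B')⁻¹`.
  refine ⟨V, ⟨W, fun x y => ?_⟩, hV₁, hV₂⟩
  have hx : V x + B (V x) = x := congrArg (fun S : E →L[ℂ] E => S x) hV₁
  have hy : W y + B' (W y) = y := congrArg (fun S : E →L[ℂ] E => S y) hW₁
  calc inner A (V x) y = inner A (V x) (W y + B' (W y)) := by rw [hy]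
    _ = inner A (V x + B (V x)) (W y) := by
      rw [CStarModule.inner_add_left, CStarModule.inner_add_right, h]
    _ = inner A x (W y) := by rw [hx]

/-! ### The compact operators form an ideal -/

variable [StarOrderedRing A]

/-- A continuous linear map that preserves rank one operators preserves their closed span. Left and
right multiplication by adjointable operators are of this kind. -/
theorem map_mem_compactOperators {Φ : (E →L[ℂ] E) →L[ℂ] (E →L[ℂ] E)}
    (hΦ : ∀ x y : E, ∃ x' y' : E, Φ (rankOne A x y) = rankOne A x' y') {k : E →L[ℂ] E}
    (hk : k ∈ compactOperators A E) : Φ k ∈ compactOperators A E := by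
  refine map_mem_closure Φ.continuous hk fun l hl => ?_
  refine (Submodule.span_le.mpr ?_ : _ ≤ Submodule.comap (Φ : (E →L[ℂ] E) →ₗ[ℂ] (E →L[ℂ] E))
    (Submodule.span ℂ (Set.range fun p : E × E => rankOne A p.1 p.2))) hl
  rintro _ ⟨p, rfl⟩
  obtain ⟨x', y', h⟩ := hΦ p.1 p.2
  exact Submodule.subset_span ⟨(x', y'), h.symm⟩

theorem IsAdjointable.mul_mem_compactOperators {V k : E →L[ℂ] E} (hV : IsAdjointable A V)
    (hk : k ∈ compactOperators A E) : V * k ∈ compactOperators A E :=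
  map_mem_compactOperators (Φ := ContinuousLinearMap.mul ℂ (E →L[ℂ] E) V)
    (fun x y => ⟨V x, y, ContinuousLinearMap.ext fun _ => hV.map_op_smul _ _⟩) hk

theorem IsAdjointable.mem_compactOperators_mul {V k : E →L[ℂ] E} (hV : IsAdjointable A V)
    (hk : k ∈ compactOperators A E) : k * V ∈ compactOperators A E := by
  obtain ⟨V', hV⟩ := hV
  refine map_mem_compactOperators (Φ := (ContinuousLinearMap.mul ℂ (E →L[ℂ] E)).flip V)
    (fun x y => ⟨x, V' y, ContinuousLinearMap.ext fun z => ?_⟩) hk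
  change (inner A y (V z) : A) • x = (inner A (V' y) z : A) • x
  rw [inner_eq_of_inner_eq hV]

/-! ### Pseudo inverses -/

theorem mem_graph_toPMap_top {S : E →L[ℂ] E} {p : E × E} :
    p ∈ ((S : E →ₗ[ℂ] E).toPMap ⊤).graph ↔ p.2 = S p.1 := by
  rw [LinearPMap.mem_graph_iff]
  constructor
  · rintro ⟨x, hx, hx'⟩
    rw [← hx, ← hx']
    rfl
  · exact fun h => ⟨⟨p.1, trivial⟩, rfl, h.symm⟩

/-- The graph of `S` is closed, and its points over a dense domain are dense in it. -/
theorem graph_topologicalClosure_eq {T : E →ₗ.[ℂ] E} {S : E →L[ℂ] E}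
    (hT : Dense (T.domain : Set E)) (hS : ∀ x : T.domain, T x = S x) :
    T.graph.topologicalClosure = ((S : E →ₗ[ℂ] E).toPMap ⊤).graph := by
  refine le_antisymm (Submodule.topologicalClosure_minimal _ ?_ ?_) fun p hp => ?_
  · intro p hp
    obtain ⟨x, hx, hx'⟩ := T.mem_graph_iff.mp hp
    rw [mem_graph_toPMap_top, ← hx, ← hx', hS]
  · have : (((S : E →ₗ[ℂ] E).toPMap ⊤).graph : Set (E × E)) = {p | p.2 = S p.1} :=
      Set.ext fun p => mem_graph_toPMap_top
    rw [this]
    exact isClosed_eq continuous_snd (S.continuous.comp continuous_fst)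
  · have hp' : p = (p.1, S p.1) := Prod.ext rfl (mem_graph_toPMap_top.mp hp)
    rw [hp']
    exact map_mem_closure (f := fun x : E => (x, S x)) (by fun_prop) (hT p.1) fun x hx =>
      T.mem_graph_iff.mpr ⟨⟨x, hx⟩, rfl, hS ⟨x, hx⟩⟩

/-- A densely defined restriction of a bounded operator has that operator as its closure. -/
theorem closureCongrOne_of_forall_eq {T : E →ₗ.[ℂ] E} {S : E →L[ℂ] E}
    (hT : Dense (T.domain : Set E)) (hS : ∀ x : T.domain, T x = S x) (hS' : IsAdjointable A S)
    (hSk : S - 1 ∈ compactOperators A E) : ClosureCongrOne A T := by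
  have hcl : T.IsClosable := ⟨_, graph_topologicalClosure_eq hT hS⟩
  refine ⟨hcl, S, hS', LinearPMap.eq_of_eq_graph ?_, hSk⟩
  rw [← hcl.graph_closure_eq_closure_graph, graph_topologicalClosure_eq hT hS]

theorem apply_eq_of_closure_eq {T : E →ₗ.[ℂ] E} {S : E →L[ℂ] E}
    (h : T.closure = (S : E →ₗ[ℂ] E).toPMap ⊤) (x : T.domain) : T x = S x := by
  have := LinearPMap.le_graph_of_le T.le_closure (T.mem_graph x)
  rw [h] at this
  exact mem_graph_toPMap_top.mp this

/-- If the closure of `t G` is everywhere defined and `t` is closed, then so is `t G`. -/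
theorem exists_apply_eq_of_closure_compBounded_eq {t : E →ₗ.[ℂ] E} {G S : E →L[ℂ] E}
    (ht : t.IsClosed) (hcl : (compBounded t G).IsClosable)
    (h : (compBounded t G).closure = (S : E →ₗ[ℂ] E).toPMap ⊤) (x : E) :
    ∃ hx : G x ∈ t.domain, t ⟨G x, hx⟩ = S x := by
  have hmem : (x, S x) ∈ (compBounded t G).graph.topologicalClosure := by
    rw [hcl.graph_closure_eq_closure_graph, h]
    exact mem_graph_toPMap_top.mpr rfl
  -- `(x, S x)` is a limit of pairs `(y, t (G y))`; applying `G` to first coordinates gives a limit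
  -- of points of the graph of `t`.
  have hgraph : (G x, S x) ∈ closure (t.graph : Set (E × E)) :=
    map_mem_closure (f := fun p : E × E => (G p.1, p.2)) (by fun_prop) hmem fun p hp => by
      obtain ⟨y, hy, hy'⟩ := (compBounded t G).mem_graph_iff.mp hp
      refine t.mem_graph_iff.mpr ⟨⟨G y, y.2⟩, ?_, hy'⟩
      change G y = G p.1
      rw [hy]
  rw [ht.closure_eq] at hgraph
  obtain ⟨y, hy, hy'⟩ := t.mem_graph_iff.mp hgraph
  obtain ⟨y, hyt⟩ := y
  obtain rfl : y = G x := hy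
  exact ⟨hyt, hy'⟩

/-- Pseudo left inverses survive small bounded perturbations. -/
theorem exists_isPseudoLeftInverse_vadd [CompleteSpace E] {t : E →ₗ.[ℂ] E} {D G G' : E →L[ℂ] E}
    (ht : Dense (t.domain : Set E)) (hG : IsPseudoLeftInverse A G t)
    (hG' : ∀ x y : E, inner A (G x) y = inner A x (G' y)) (hD : IsSelfAdjointBounded A D)
    (hGD : ‖G‖ * ‖D‖ < 1) (hGD' : ‖G'‖ * ‖D‖ < 1) :
    ∃ H, IsPseudoLeftInverse A H ((D : E →ₗ[ℂ] E) +ᵥ t) := by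
  obtain ⟨hGa, -, S, hSa, hS, hSk⟩ := hG
  obtain ⟨V, hVa, -, hV⟩ := exists_isAdjointable_inverse_one_add (A := A) (B := G * D)
    (B' := D * G') (fun x y => by simp [hG', hD (x := x)]) ((norm_mul_le _ _).trans_lt hGD)
    ((norm_mul_le _ _).trans_lt (by rwa [mul_comm]))
  -- Split `S + GD = (1 + GD) + (S - 1)`: `V` inverts the first summand, and the second is compact.
  have hVS : V * (S + G * D) = 1 + V * (S - 1) := by
    calc V * (S + G * D) = V * (1 + G * D) + V * (S - 1) := by rw [← mul_add]; congr 1; abel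
      _ = 1 + V * (S - 1) := by rw [hV]
  refine ⟨V * G, hVa.mul hGa, closureCongrOne_of_forall_eq (S := V * (S + G * D)) ht (fun x => ?_)
    (hVa.mul (hSa.add (hGa.mul hD.isAdjointable))) ?_⟩
  · have hx : G (t x) = S x := apply_eq_of_closure_eq hS x
    change V (G (D x + t x)) = V (S x + G (D x))
    rw [map_add, hx, add_comm]
  · rw [hVS, add_sub_cancel_left]
    exact hVa.mul_mem_compactOperators hSk

/-- Pseudo right inverses of closed operators survive small bounded perturbations. -/
theorem exists_isPseudoRightInverse_vadd [CompleteSpace E] {t : E →ₗ.[ℂ] E} {D G G' : E →L[ℂ] E}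
    (ht : t.IsClosed) (hG : IsPseudoRightInverse A G t)
    (hG' : ∀ x y : E, inner A (G x) y = inner A x (G' y)) (hD : IsSelfAdjointBounded A D)
    (hGD : ‖G‖ * ‖D‖ < 1) (hGD' : ‖G'‖ * ‖D‖ < 1) :
    ∃ H, IsPseudoRightInverse A H ((D : E →ₗ[ℂ] E) +ᵥ t) := by
  obtain ⟨hGa, hcl, S, hSa, hS, hSk⟩ := hG
  obtain ⟨V, hVa, hV, -⟩ := exists_isAdjointable_inverse_one_add (A := A) (B := D * G)
    (B' := G' * D) (fun x y => by simp [hG', hD (x := G x)])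
    ((norm_mul_le _ _).trans_lt (by rwa [mul_comm])) ((norm_mul_le _ _).trans_lt hGD')
  have hSV : (S + D * G) * V = 1 + (S - 1) * V := by
    calc (S + D * G) * V = (1 + D * G) * V + (S - 1) * V := by rw [← add_mul]; congr 1; abel
      _ = 1 + (S - 1) * V := by rw [hV]
  have hdom := exists_apply_eq_of_closure_compBounded_eq ht hcl hS
  refine ⟨G * V, hGa.mul hVa, closureCongrOne_of_forall_eq (S := (S + D * G) * V) ?_ (fun x => ?_)
    ((hSa.add (hD.isAdjointable.mul hGa)).mul hVa) ?_⟩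
  · exact dense_univ.mono fun x _ => (hdom (V x)).1
  · obtain ⟨h, hx⟩ := hdom (V x)
    change D (G (V x)) + t ⟨G (V x), h⟩ = S (V x) + D (G (V x))
    rw [hx, add_comm]
  · rw [hSV, add_sub_cancel_left]
    exact hVa.mem_compactOperators_mul hSk

/-! ### Selfadjoint operators -/

theorem mem_graph_vadd {t : E →ₗ.[ℂ] E} {D : E →L[ℂ] E} {p : E × E} :
    p ∈ ((D : E →ₗ[ℂ] E) +ᵥ t).graph ↔ (p.1, p.2 - D p.1) ∈ t.graph := by
  rw [LinearPMap.mem_graph_iff, LinearPMap.mem_graph_iff]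
  refine exists_congr fun x => and_congr_right fun hx => ?_
  change D x + t x = p.2 ↔ t x = p.2 - D p.1
  rw [hx, eq_sub_iff_add_eq, add_comm]

theorem graph_eq_adjointGraph {t : E →ₗ.[ℂ] E} (ht : Dense (t.domain : Set E))
    (hsa : IsSelfAdjointOp A t) : t.graph = adjointGraph A t := by
  rw [← graph_adjoint A t ht, hsa]

theorem IsSelfAdjointOp.inner_left_eq {t : E →ₗ.[ℂ] E} (ht : Dense (t.domain : Set E))
    (hsa : IsSelfAdjointOp A t) (x y : t.domain) :
    inner A (t x) (y : E) = (inner A (x : E) (t y) : A) := by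
  have h : ((y : E), t y) ∈ adjointGraph A t := graph_eq_adjointGraph ht hsa ▸ t.mem_graph y
  exact h x

theorem isClosed_vadd {t : E →ₗ.[ℂ] E} (ht : t.IsClosed) (D : E →L[ℂ] E) :
    ((D : E →ₗ[ℂ] E) +ᵥ t).IsClosed := by
  have : (((D : E →ₗ[ℂ] E) +ᵥ t).graph : Set (E × E)) =
      (fun p : E × E => (p.1, p.2 - D p.1)) ⁻¹' t.graph := by
    ext p
    exact mem_graph_vadd
  rw [LinearPMap.IsClosed, this]
  exact ht.preimage (by fun_prop)

theorem isSelfAdjointOp_vadd {t : E →ₗ.[ℂ] E} {D : E →L[ℂ] E} (ht : Dense (t.domain : Set E))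
    (hsa : IsSelfAdjointOp A t) (hD : IsSelfAdjointBounded A D) :
    IsSelfAdjointOp A ((D : E →ₗ[ℂ] E) +ᵥ t) := by
  refine LinearPMap.eq_of_eq_graph ?_
  rw [graph_adjoint A ((D : E →ₗ[ℂ] E) +ᵥ t) ht]
  ext p
  rw [mem_graph_vadd, graph_eq_adjointGraph ht hsa]
  refine forall_congr' fun x => ?_
  change inner A (D x + t x) p.1 = inner A (x : E) p.2 ↔
    inner A (t x) p.1 = (inner A (x : E) (p.2 - D p.1) : A)
  rw [CStarModule.inner_add_left, CStarModule.inner_sub_right, hD, eq_sub_iff_add_eq, add_comm]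

/-- For a selfadjoint `t` and `c = ±i`, one has `⟪(t + c) x, (t + c) x⟫ = ⟪t x, t x⟫ + ⟪x, x⟫`. -/
theorem IsSelfAdjointOp.inner_add_smul_self {t : E →ₗ.[ℂ] E} (ht : Dense (t.domain : Set E))
    (hsa : IsSelfAdjointOp A t) {c : ℂ} (hc : c * c = -1) (hc' : star c = -c) (x : t.domain) :
    inner A (t x + c • (x : E)) (t x + c • (x : E)) =
      inner A (t x) (t x) + (inner A (x : E) (x : E) : A) := by
  simp only [CStarModule.inner_add_left, CStarModule.inner_add_right,
    CStarModule.inner_smul_left_complex, CStarModule.inner_smul_right_complex,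
    hsa.inner_left_eq ht, hc', smul_add, neg_smul, smul_neg, smul_smul, hc, one_smul]
  abel

variable (A) in
theorem norm_le_of_inner_self_le {x y : E} (h : inner A x x ≤ (inner A y y : A)) : ‖x‖ ≤ ‖y‖ := by
  refine le_of_sq_le_sq ?_ (norm_nonneg y)
  rw [CStarModule.norm_sq_eq A, CStarModule.norm_sq_eq A]
  exact CStarAlgebra.norm_le_norm_of_nonneg_of_le CStarModule.inner_self_nonneg h

/-- The cross terms cancel because `c` is imaginary, so `t + c` is bounded below in the (sup) graph
norm. This yields injectivity and closed range. -/
theorem IsSelfAdjointOp.norm_le_norm_add_smul {t : E →ₗ.[ℂ] E} (ht : Dense (t.domain : Set E))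
    (hsa : IsSelfAdjointOp A t) {c : ℂ} (hc : c * c = -1) (hc' : star c = -c) (x : t.domain) :
    ‖((x : E), t x)‖ ≤ ‖t x + c • (x : E)‖ := by
  refine max_le ?_ ?_ <;> refine norm_le_of_inner_self_le A ?_ <;>
    rw [hsa.inner_add_smul_self ht hc hc']
  · exact le_add_of_nonneg_left CStarModule.inner_self_nonneg
  · exact le_add_of_nonneg_right CStarModule.inner_self_nonneg

/-- A selfadjoint regular operator has a contractive resolvent at `±i`. -/
theorem IsRegular.exists_resolvent [CompleteSpace E] {t : E →ₗ.[ℂ] E} (ht : IsRegular A t)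
    (hsa : IsSelfAdjointOp A t) {c : ℂ} (hc : c * c = -1) (hc' : star c = -c) :
    ∃ R : E →L[ℂ] E, ‖R‖ ≤ 1 ∧ ∀ z, ∃ h : R z ∈ t.domain, t ⟨R z, h⟩ + c • R z = z := by
  let φ : t.graph →L[ℂ] E := (ContinuousLinearMap.snd ℂ E E +
    c • ContinuousLinearMap.fst ℂ E E).comp t.graph.subtypeL
  have hφ : ∀ p : t.graph, φ p = p.1.2 + c • p.1.1 := fun p => rfl
  have hbound : ∀ p : t.graph, ‖p‖ ≤ ‖φ p‖ := fun ⟨p, hp⟩ => by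
    obtain ⟨x, hx, hx'⟩ := t.mem_graph_iff.mp hp
    have := hsa.norm_le_norm_add_smul ht.dense_domain hc hc' x
    rw [hx, hx'] at this
    exact this
  have hanti : AntilipschitzWith 1 φ :=
    φ.antilipschitz_of_bound fun p => by simpa using hbound p
  have : CompleteSpace t.graph := ht.isClosed.completeSpace_coe
  have hrange : IsClosed (Set.range φ) := hanti.isClosed_range φ.uniformContinuous
  have hdense : Dense (Set.range φ) := by
    have hd := ht.dense_range
    rw [show adjoint A t = t from hsa] at hd
    refine hd.mono ?_
    rintro z ⟨x, hx, rfl⟩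
    -- Since `c² = -1`, `(t + c)(t - c) = 1 + t²`, so the range of `t + c` contains the dense range
    -- of `1 + t²`.
    let y : t.domain := ⟨t x, hx⟩ - c • x
    refine ⟨⟨((y : E), t y), t.mem_graph y⟩, ?_⟩
    rw [hφ]
    change t (⟨t x, hx⟩ - c • x) + c • (t x - c • (x : E)) = x + t ⟨t x, hx⟩
    rw [LinearPMap.map_sub, LinearPMap.map_smul, smul_sub, smul_smul, hc, neg_smul, one_smul]
    abel
  have hsurj : Function.Surjective φ := by
    rw [← Set.range_eq_univ, ← hrange.closure_eq, hdense.closure_eq]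
  choose ψ hψ using hsurj
  let R : E →L[ℂ] E := LinearMap.mkContinuous
    { toFun := fun z => (ψ z).1.1
      map_add' := fun z w => by
        have : ψ (z + w) = ψ z + ψ w := hanti.injective (by rw [map_add, hψ, hψ, hψ])
        rw [this]
        rfl
      map_smul' := fun a z => by
        have : ψ (a • z) = a • ψ z := hanti.injective (by rw [map_smul, hψ, hψ])
        rw [this]
        rfl } 1 fun z => by
    rw [one_mul]
    calc ‖(ψ z).1.1‖ ≤ ‖ψ z‖ := norm_fst_le (ψ z).1
      _ ≤ ‖z‖ := by simpa only [hψ] using hbound (ψ z)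
  refine ⟨R, LinearMap.mkContinuous_norm_le _ zero_le_one _, fun z => ?_⟩
  obtain ⟨x, hx, hx'⟩ := t.mem_graph_iff.mp (ψ z).2
  have hR : R z = x := hx.symm
  refine ⟨hR ▸ x.2, ?_⟩
  have hz := hψ z
  rw [hφ, ← hx, ← hx'] at hz
  simpa only [hR] using hz

/-- With `R` the resolvent, `(T + c)R = 1 + DR`, which is invertible because `‖DR‖ < 1`. -/
theorem IsRegular.exists_vadd_add_smul_eq [CompleteSpace E] {t : E →ₗ.[ℂ] E} {D : E →L[ℂ] E}
    (ht : IsRegular A t) (hsa : IsSelfAdjointOp A t) (hD : ‖D‖ < 1) {c : ℂ} (hc : c * c = -1)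
    (hc' : star c = -c) (w : E) :
    ∃ x : t.domain, ((D : E →ₗ[ℂ] E) +ᵥ t) x + c • (x : E) = w := by
  obtain ⟨R, hR, h⟩ := ht.exists_resolvent hsa hc hc'
  have hDR : ‖-(D * R)‖ < 1 := by
    rw [norm_neg]
    calc ‖D * R‖ ≤ ‖D‖ * ‖R‖ := norm_mul_le _ _
      _ ≤ ‖D‖ * 1 := by gcongr
      _ < 1 := by rwa [mul_one]
  have hz := congrArg (fun S : E →L[ℂ] E => S w) (Units.oneSub _ hDR).mul_inv
  set z := (↑(Units.oneSub _ hDR)⁻¹ : E →L[ℂ] E) w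
  replace hz : z - -(D (R z)) = w := hz
  obtain ⟨hRz, hz'⟩ := h z
  refine ⟨⟨R z, hRz⟩, ?_⟩
  change D (R z) + t ⟨R z, hRz⟩ + c • R z = w
  rw [add_assoc, hz', ← hz]
  abel

/-- The regularity of selfadjoint regular operators survives selfadjoint perturbations of norm less
than one. -/
theorem IsRegular.vadd [CompleteSpace E] {t : E →ₗ.[ℂ] E} {D : E →L[ℂ] E} (ht : IsRegular A t)
    (hsa : IsSelfAdjointOp A t) (hD : IsSelfAdjointBounded A D) (hD' : ‖D‖ < 1) :
    IsRegular A ((D : E →ₗ[ℂ] E) +ᵥ t) := by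
  have hT : adjoint A ((D : E →ₗ[ℂ] E) +ᵥ t) = (D : E →ₗ[ℂ] E) +ᵥ t :=
    isSelfAdjointOp_vadd ht.dense_domain hsa hD
  refine ⟨isModuleMap_vadd ht.isModuleMap hD.isAdjointable, isClosed_vadd ht.isClosed D,
    ht.dense_domain, ?_, ?_⟩
  · rw [hT]
    exact ht.dense_domain
  · rw [hT]
    have solve := fun {c : ℂ} => ht.exists_vadd_add_smul_eq hsa hD' (c := c)
    set T := (D : E →ₗ[ℂ] E) +ᵥ t
    refine dense_univ.mono fun z _ => ?_
    -- Solve `(T + i)y = z`, then `(T - i)x = y`; thus `(1 + T²)x = z`.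
    obtain ⟨y, hy⟩ := solve Complex.I_mul_I (by simp) z
    obtain ⟨x, hx⟩ := solve (c := -Complex.I) (by simp) (by simp) y
    replace hx : T x = y + Complex.I • (x : E) := by
      rw [← hx, neg_smul]
      abel
    have hmem : T x ∈ T.domain := hx ▸ T.domain.add_mem y.2 (T.domain.smul_mem _ x.2)
    refine ⟨x, hmem, ?_⟩
    have : (⟨T x, hmem⟩ : T.domain) = (y : T.domain) + Complex.I • (x : T.domain) :=
      Subtype.ext hx
    rw [this, LinearPMap.map_add, LinearPMap.map_smul, hx, smul_add, smul_smul, Complex.I_mul_I,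
      neg_smul, one_smul, ← hy]
    abel

end HilbertCStar

end

theorem mainTheorem5 {A E : Type*} [NonUnitalCStarAlgebra A] [PartialOrder A] [StarOrderedRing A]
    [NormedAddCommGroup E] [NormedSpace ℂ E] [SMul A E] [CStarModule A E] [CompleteSpace E]
    (t : E →ₗ.[ℂ] E) (ht_reg : HilbertCStar.IsRegular A t)
    (ht_sa : HilbertCStar.IsSelfAdjointOp A t) (ht_fred : HilbertCStar.IsFredholm A t) :
    ∃ ε : ℝ, 0 < ε ∧ ∀ D : E →L[ℂ] E, HilbertCStar.IsSelfAdjointBounded A D → ‖D‖ ≤ ε →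
      HilbertCStar.IsRegular A ((D : E →ₗ[ℂ] E) +ᵥ t) ∧
      HilbertCStar.IsSelfAdjointOp A ((D : E →ₗ[ℂ] E) +ᵥ t) ∧
      HilbertCStar.IsFredholm A ((D : E →ₗ[ℂ] E) +ᵥ t) := by
  obtain ⟨-, ⟨G, hG⟩, ⟨H, hH⟩⟩ := ht_fred
  obtain ⟨G', hG'⟩ := hG.1
  obtain ⟨H', hH'⟩ := hH.1
  -- `M` dominates each factor that must satisfy `r‖D‖ < 1`: `1` for regularity, the four norms for
  -- the Neumann inverses and their adjoints.
  set M := 1 + ‖G‖ + ‖G'‖ + ‖H‖ + ‖H'‖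
  have hM : 0 < 1 + M := by positivity
  refine ⟨(1 + M)⁻¹, inv_pos.mpr hM, fun D hD hDε => ?_⟩
  have small : ∀ r : ℝ, 0 ≤ r → r ≤ M → r * ‖D‖ < 1 := fun r hr hrM =>
    calc r * ‖D‖ ≤ M * (1 + M)⁻¹ := by gcongr
      _ < 1 := by rw [mul_inv_lt_iff₀ hM]; linarith
  have hG0 := norm_nonneg G
  have hG0' := norm_nonneg G'
  have hH0 := norm_nonneg H
  have hH0' := norm_nonneg H'
  have hD1 : ‖D‖ < 1 := by simpa using small 1 zero_le_one (by linarith)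
  have hreg := ht_reg.vadd ht_sa hD hD1
  exact ⟨hreg, HilbertCStar.isSelfAdjointOp_vadd ht_reg.dense_domain ht_sa hD, hreg,
    HilbertCStar.exists_isPseudoLeftInverse_vadd ht_reg.dense_domain hG hG' hD
      (small _ hG0 (by linarith)) (small _ hG0' (by linarith)),
    HilbertCStar.exists_isPseudoRightInverse_vadd ht_reg.isClosed hH hH' hD
      (small _ hH0 (by linarith)) (small _ hH0' (by linarith))⟩
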